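/- Fix $p\in[0,1]$ and $\varepsilon>0$. Let $(C_{i,j})_{0\le i<j}$ be i.i.d. Bernoulli$(p)$ link capacities and let $G_n$ be the graph on $\{0,1,\dots,n\}$ whose links are the pairs $\{i,j\}$ with $C_{i,j}=1$ (so $G_n$ is $G(n+1,p)$). For each $n$ let $(D^{(n)}_{i,j})_{i<j}$ be fair coins such that all the $C_{i,j}$ and $D^{(n)}_{i,j}$ together are independent (nothing is assumed on the joint law of the coins for different $n$). Put $m_n=\lceil np(1-\varepsilon)/2\rceil$ if this is nonnegative and $m_n=0$ otherwise. Algorithm ALLCAST on $G_n$ with source $0$, which alone has the bits $b_1,\dots,b_{m_n}$ at the start: - Orientation. Every link $\{0,j\}$ is directed from $0$ to $j$; every other link $\{i,j\}$ is directed one way or the other according to its fair coin $D^{(n)}_{i,j}$. - Push step 1. If the source has at least $m_n$ neighbours, it sends the bits $b_1,\dots,b_{m_n}$ to $m_n$ different neighbours, one bit to each; the recipient of $b_k$ is the owner $O_k$ of $b_k$. The choice is made by a fixed rule that sees only the set of neighbours of $0$. (With fewer neighbours, some of the bits are not sent.) All nodes other than $0$ and the owners are relays. - Push step 2. Each owner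 $O_k$ sends $b_k$ along all links directed away from $O_k$. - Pull step 1. Each node collects the bits sent to it by owners. - Pull step 2. Each node $j$ determines the bits it still lacks and, for each relay $r$ with a link $r\to j$, the set of bits that $r$ has received directly from owners. By a fixed rule that sees only these data, it computes a matching of lacking bits to such relays (each used relay has the bit it is matched to and supplies one bit to $j$), covering all lacking bits whenever such a matching exists, and pulls the bits accordingly. ALLCAST succeeds on $G_n$ if at the end every node has all $m_n$ bits, every transmission goes over an existing link in its direction and sends a bit that the sender has at that time, and every link carries at most one bit in total over all the steps and both directions. Theorem. For every choice of the rules, almost surely, for all but finitely many $n$: 1. ALLCAST succeeds on $G_n$, i.e. it distributes all $m_n\ge np(1-\varepsilon)/2$ bits to every node; 2. $G_n$, which is $G(n+1,p)$, contains at least $(n+1)p(1-\varepsilon)/2$ pairwise edge-disjoint spanning trees, each of depth at most $3$ when rooted at $0$. -/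

import Mathlib

open MeasureTheory ProbabilityTheory Filter

namespace Allcast

/-- A link between two distinct nodes of `{0, 1, 2, …}`, written with its smaller endpoint first. -/
abbrev Link : Type := {e : ℕ × ℕ // e.1 < e.2}

/-- The graph on the nodes `0, 1, …, n` whose links are those of capacity one (`c e = true`);
links of capacity zero (`c e = false`) are absent. -/
def graph (n : ℕ) (c : Link → Bool) : SimpleGraph (Fin (n + 1)) :=
  SimpleGraph.fromRel fun u v => ∃ h : (u : ℕ) < (v : ℕ), c ⟨((u : ℕ), (v : ℕ)), h⟩ = true

/-- Orientation step: `orient n c d u v` says that the link `{u, v}` is present and directed from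
`u` to `v`. A link `{0, j}` at the source points away from the source. A link `{i, j}` with
`1 ≤ i < j` points from `i` to `j` if its coin `d` shows `true`, and from `j` to `i` otherwise. -/
def orient (n : ℕ) (c d : Link → Bool) (u v : Fin (n + 1)) : Prop :=
  (∃ h : (u : ℕ) < (v : ℕ), c ⟨((u : ℕ), (v : ℕ)), h⟩ = true ∧
      (u = 0 ∨ d ⟨((u : ℕ), (v : ℕ)), h⟩ = true)) ∨
  (∃ h : (v : ℕ) < (u : ℕ), c ⟨((v : ℕ), (u : ℕ)), h⟩ = true ∧
      v ≠ 0 ∧ d ⟨((v : ℕ), (u : ℕ)), h⟩ = false)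

/-- A rule by which the source hands one bit each to different neighbours of its own. The rule
sees only the set `S` of the neighbours of the source. All `m` bits are handed out
whenever there are at least `m` neighbours. -/
structure PushRule (V : Type*) (m : ℕ) where
  /-- `owner S b` is the node that receives the bit `b`, if there is one. -/
  owner : Finset V → Fin m → Option V
  mem : ∀ S b v, owner S b = some v → v ∈ S
  inj : ∀ S b b' v, owner S b = some v → owner S b' = some v → b = b'
  complete : ∀ S : Finset V, m ≤ S.card → ∀ b, (owner S b).isSome

/-- A rule by which a node matches the bits it still needs to helper nodes. The rule sees only the
set `N` of the needed bits and, for every node `r`, the set `A r` of the bits that `r` offers to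
this node. It outputs a matching (each used helper offers the bit it is matched to and
accounts for one bit only), which covers all of `N` whenever some matching does. -/
structure PullRule (V : Type*) (m : ℕ) where
  /-- `helper N A b` is the node from which the bit `b` is pulled, if there is one. -/
  helper : Finset (Fin m) → (V → Finset (Fin m)) → Fin m → Option V
  sound : ∀ N A b r, helper N A b = some r → b ∈ N ∧ b ∈ A r
  inj : ∀ N A b b' r, helper N A b = some r → helper N A b' = some r → b = b'
  complete : ∀ (N : Finset (Fin m)) (A : V → Finset (Fin m)),
    (∃ f : Fin m → V, Set.InjOn f (N : Set (Fin m)) ∧ ∀ b ∈ N, b ∈ A (f b)) →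
      ∀ b ∈ N, (helper N A b).isSome

/-- What a run of the algorithm with `m` bits depends on: the source, the links, the outcome of
the orientation step, the rule of the source and the rules of the nodes. -/
structure Run (V : Type*) (m : ℕ) where
  source : V
  links : SimpleGraph V
  dir : V → V → Prop
  push : PushRule V m
  pull : V → PullRule V m

/-- The steps of the algorithm in which bits travel over links. In the first pull step a node
collects the bits that the owners have sent to it in the second push step. -/
inductive Step : Type
  | push1
  | push2
  | pull2

namespace Run

variable {V : Type*} [Fintype V] {m : ℕ}

open Classical in
/-- The owner of the bit `b`. -/
noncomputable def owner (R : Run V m) (b : Fin m) : Option V :=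
  R.push.owner (Finset.univ.filter fun v => R.links.Adj R.source v) b

/-- The relays are the nodes other than the source that do not own a bit. -/
def IsRelay (R : Run V m) (v : V) : Prop :=
  v ≠ R.source ∧ ∀ b, R.owner b ≠ some v

/-- Push step 1: the source sends each bit to its owner. -/
def Push1 (R : Run V m) (u v : V) (b : Fin m) : Prop :=
  u = R.source ∧ R.owner b = some v

/-- Push step 2: each owner sends its bit along all its outward links. -/
def Push2 (R : Run V m) (u v : V) (b : Fin m) : Prop :=
  R.owner b = some u ∧ R.dir u v

/-- At the start, the source alone has the bits. -/
def Has0 (R : Run V m) (v : V) (_b : Fin m) : Prop :=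
  v = R.source

/-- `v` has the bit `b` after push step 1. -/
def Has1 (R : Run V m) (v : V) (b : Fin m) : Prop :=
  R.Has0 v b ∨ ∃ u, R.Push1 u v b

/-- `v` has the bit `b` after push step 2 and pull step 1. -/
def Has2 (R : Run V m) (v : V) (b : Fin m) : Prop :=
  R.Has1 v b ∨ ∃ u, R.Push2 u v b

open Classical in
/-- The bits that `v` still needs after pull step 1. -/
noncomputable def needed (R : Run V m) (v : V) : Finset (Fin m) :=
  Finset.univ.filter fun b => ¬ R.Has2 v b

open Classical in
/-- The bits that `r` offers to `v`: if `r` is a relay with a link directed from `r` to `v`, the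
bits that `r` has after the push steps, and no bits otherwise. -/
noncomputable def offers (R : Run V m) (v r : V) : Finset (Fin m) :=
  Finset.univ.filter fun b => R.IsRelay r ∧ R.dir r v ∧ R.Has2 r b

/-- Pull step 2: each node pulls its needed bits from the helper relays given by its matching. -/
def Pull2 (R : Run V m) (u v : V) (b : Fin m) : Prop :=
  (R.pull v).helper (R.needed v) (R.offers v) b = some u

/-- `v` has the bit `b` at the end. -/
def Has3 (R : Run V m) (v : V) (b : Fin m) : Prop :=
  R.Has2 v b ∨ ∃ u, R.Pull2 u v b

/-- In the given step the bit `b` is sent from `u` to `v`. -/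
def Sent (R : Run V m) : Step → V → V → Fin m → Prop
  | .push1 => R.Push1
  | .push2 => R.Push2
  | .pull2 => R.Pull2

/-- `v` has the bit `b` just before the given step. -/
def HasBefore (R : Run V m) : Step → V → Fin m → Prop
  | .push1 => R.Has0
  | .push2 => R.Has1
  | .pull2 => R.Has2

/-- The run succeeds: every node ends up with every bit, every transmission goes over an existing
link in the direction of that link and sends a bit that the sender has at that time, and each link
carries at most one bit, over all steps and both directions together. -/
def Succeeds (R : Run V m) : Prop :=
  (∀ v b, R.Has3 v b) ∧
  (∀ k u v b, R.Sent k u v b → R.links.Adj u v ∧ R.dir u v ∧ R.HasBefore k u b) ∧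
  (∀ k u v b k' u' v' b', R.Sent k u v b → R.Sent k' u' v' b' → s(u, v) = s(u', v') →
    k = k' ∧ u = u' ∧ v = v' ∧ b = b')

end Run

/-- The run of ALLCAST with `m` bits on the nodes `0, 1, …, n` with source `0`, for link
capacities `c`, direction coins `d` and given rules. -/
def allcast (n : ℕ) {m : ℕ} (c d : Link → Bool) (push : PushRule (Fin (n + 1)) m)
    (pull : Fin (n + 1) → PullRule (Fin (n + 1)) m) : Run (Fin (n + 1)) m where
  source := 0
  links := graph n c
  dir := orient n c d
  push := push
  pull := pull

/-- `G` contains `k` pairwise edge-disjoint spanning trees, each of which has depth at most `h` when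
rooted at `s`. -/
def PacksSpanningTrees {V : Type*} (G : SimpleGraph V) (s : V) (k h : ℕ) : Prop :=
  ∃ T : Fin k → SimpleGraph V,
    (∀ i, T i ≤ G ∧ (T i).IsTree ∧ ∀ v, (T i).dist s v ≤ h) ∧
    (∀ i j, i ≠ j → Disjoint (T i).edgeSet (T j).edgeSet)

/-- The number of bits: `N p (1 - ε) / 2`, rounded up (`0` if this is negative). -/
noncomputable def numBits (N : ℕ) (p ε : ℝ) : ℕ := ⌈(N : ℝ) * p * (1 - ε) / 2⌉₊

end Allcast

/-! ### Trees described by parent maps -/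

namespace Allcast

/-! Success is reduced to a matching problem at each node, and the matching to Hall's condition. The
source has about `np` neighbours and every other node `j` has about `np/2` in-neighbours other than
the source, so by Hoeffding's inequality the in-neighbours exceed the number `m` of bits by some `k`
linear in `n`. An in-neighbour of `j` that owns a bit is not a relay, but it delivers its bit to
`j`. Hence the relays pointing to `j` still exceed the bits that `j` needs by at least `k`.

If Hall's condition fails for a set `S` of needed bits, let `U` be the set of relays that can supply
some bit of `S`. Then `U` has fewer elements than `S`, so at least `k` relays pointing to `j` lie
outside `U`, and no owner of a bit in `S` has a link to any of them. Owners and relays are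
determined by the links at `0` and `j`, whereas the links from owners to relays avoid `0` and `j`
and are independent of these. So for fixed `S` and `U` the probability is at most `exp(-p|S|k/2)`.
As `k` is linear in `n`, this outweighs the number of pairs `(S, U)`. The failure probabilities are
summable in `n`, and the Borel–Cantelli lemma, which needs no independence between different `n`,
gives the first claim.

For the second claim, the routes by which one bit reaches all nodes form a spanning tree of depth at
most 3, and trees of different bits are disjoint because a link carries at most one bit. The count
`(n+1)p(1-ε)/2` is slightly more than the bits sent at `ε`, so the algorithm is run at `ε/2`, with
arbitrary rules; this is why rules must be shown to exist. -/

instance {V : Type*} {m : ℕ} : Nonempty (PushRule V m) := by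
  classical
  refine ⟨{
    owner := fun S b => if h : m ≤ S.card then some (S.equivFin.symm (Fin.castLE h b)).1 else none
    mem := ?_, inj := ?_, complete := ?_ }⟩
  · intro S b v h
    split_ifs at h
    cases h
    exact Subtype.prop _
  · intro S b b' v h h'
    split_ifs at h h' with hm
    have : (S.equivFin.symm (Fin.castLE hm b)) = (S.equivFin.symm (Fin.castLE hm b')) :=
      Subtype.ext ((Option.some.inj h).trans (Option.some.inj h').symm)
    simpa using this
  · intro S h b
    simp [h]

instance {V : Type*} {m : ℕ} : Nonempty (PullRule V m) := by
  classical
  refine ⟨{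
    helper := fun N A b =>
      if h : ∃ f : Fin m → V, Set.InjOn f (N : Set (Fin m)) ∧ ∀ b ∈ N, b ∈ A (f b) then
        if b ∈ N then some (h.choose b) else none
      else none
    sound := ?_, inj := ?_, complete := ?_ }⟩
  · intro N A b r hr
    split_ifs at hr with h hb
    cases hr
    exact ⟨hb, h.choose_spec.2 b hb⟩
  · intro N A b b' r hr hr'
    split_ifs at hr with h hb
    rw [dif_pos h] at hr'
    split_ifs at hr' with hb'
    exact h.choose_spec.1 hb hb' ((Option.some.inj hr).trans (Option.some.inj hr').symm)
  · intro N A h b hb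
    simp only [dif_pos h, if_pos hb, Option.isSome_some]

/-- The graph in which every node other than the root is linked to its parent. -/
def parentGraph {V : Type*} (root : V) (parent : V → V) : SimpleGraph V :=
  SimpleGraph.fromRel fun u v => u ≠ root ∧ v = parent u

section ParentGraph

variable {V : Type*} {root : V} {parent : V → V} {rank : V → ℕ}

theorem exists_walk_parentGraph (h : ∀ v, v ≠ root → rank (parent v) < rank v) :
    ∀ v, ∃ w : (parentGraph root parent).Walk root v, w.length ≤ rank v := by
  intro v
  induction hk : rank v using Nat.strong_induction_on generalizing v with
  | _ k ih =>
    by_cases hv : v = root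
    · subst hv
      exact ⟨.nil, by simp⟩
    · have hlt := h v hv
      obtain ⟨w, hw⟩ := ih _ (hk ▸ hlt) (parent v) rfl
      have hadj : (parentGraph root parent).Adj (parent v) v := by
        refine (SimpleGraph.fromRel_adj _ _ _).2 ⟨fun e => ?_, Or.inr ⟨hv, rfl⟩⟩
        rw [e] at hlt
        exact lt_irrefl _ hlt
      refine ⟨w.concat hadj, ?_⟩
      rw [SimpleGraph.Walk.length_concat]
      omega

theorem parentGraph_dist_le (h : ∀ v, v ≠ root → rank (parent v) < rank v) (v : V) :
    (parentGraph root parent).dist root v ≤ rank v := by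
  obtain ⟨w, hw⟩ := exists_walk_parentGraph h v
  exact (SimpleGraph.dist_le w).trans hw

theorem parentGraph_isTree [Fintype V] (h : ∀ v, v ≠ root → rank (parent v) < rank v) :
    (parentGraph root parent).IsTree := by
  classical
  have hconn : (parentGraph root parent).Connected := by
    have : Nonempty V := ⟨root⟩
    refine ⟨fun u v => ?_⟩
    obtain ⟨w, -⟩ := exists_walk_parentGraph h u
    obtain ⟨w', -⟩ := exists_walk_parentGraph h v
    exact ⟨w.reverse.append w'⟩
  refine SimpleGraph.isTree_iff_connected_and_card.2
    ⟨hconn, le_antisymm ?_ hconn.card_vert_le_card_edgeSet_add_one⟩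
  -- A connected graph is a tree once it has at most `|V| - 1` edges, and here each edge is charged
  -- to a child, that is, to a node other than the root.
  have hsub : (parentGraph root parent).edgeSet ⊆
      (((Finset.univ.erase root).image fun v => s(v, parent v) : Finset (Sym2 V)) : Set (Sym2 V)) := by
    intro e
    induction e using Sym2.ind with
    | _ u v =>
      intro he
      have he' := (SimpleGraph.fromRel_adj _ _ _).1 ((SimpleGraph.mem_edgeSet _).1 he)
      rcases he'.2 with ⟨hu, rfl⟩ | ⟨hv, rfl⟩
      · simpa using ⟨u, hu, Or.inl ⟨rfl, rfl⟩⟩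
      · simpa using ⟨v, hv, Or.inr ⟨rfl, rfl⟩⟩
  have h1 := Nat.card_mono (Finset.finite_toSet _) hsub
  rw [Nat.card_coe_set_eq, Nat.card_coe_set_eq, Set.ncard_coe_finset] at h1
  have h2 := h1.trans Finset.card_image_le
  rw [Finset.card_erase_of_mem (Finset.mem_univ _), Finset.card_univ] at h2
  have : 0 < Fintype.card V := Fintype.card_pos_iff.2 ⟨root⟩
  rw [Nat.card_eq_fintype_card (α := V), Nat.card_coe_set_eq]
  omega

end ParentGraph

end Allcast

/-! ### Deterministic analysis of a run -/

namespace Allcast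

namespace Run

variable {V : Type*} [Fintype V] {m : ℕ}

/-- Every link has at most one direction, and the links at the source point away from it. -/
structure Oriented (R : Run V m) : Prop where
  adj : ∀ u v, R.dir u v → R.links.Adj u v
  asymm : ∀ u v, R.dir u v → ¬ R.dir v u
  source : ∀ v, R.links.Adj R.source v → R.dir R.source v

open Classical in
/-- The neighbours of the source. -/
noncomputable def sourceNbrs (R : Run V m) : Finset V :=
  Finset.univ.filter fun v => R.links.Adj R.source v

open Classical in
/-- The nodes other than the source with a link directed to `v`. -/
noncomputable def inNbrs (R : Run V m) (v : V) : Finset V :=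
  Finset.univ.filter fun u => u ≠ R.source ∧ R.dir u v

open Classical in
/-- The relays with a link directed to `v`. -/
noncomputable def inRelays (R : Run V m) (v : V) : Finset V :=
  (R.inNbrs v).filter R.IsRelay

variable {R : Run V m}

theorem mem_inNbrs {u v : V} : u ∈ R.inNbrs v ↔ u ≠ R.source ∧ R.dir u v := by
  classical
  simp [inNbrs]

theorem mem_inRelays {u v : V} : u ∈ R.inRelays v ↔ R.IsRelay u ∧ R.dir u v := by
  classical
  simp only [inRelays, Finset.mem_filter, mem_inNbrs]
  exact ⟨fun h => ⟨h.2, h.1.2⟩, fun h => ⟨⟨h.1.1, h.2⟩, h.1⟩⟩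

theorem adj_of_owner {b : Fin m} {v : V} (h : R.owner b = some v) : R.links.Adj R.source v := by
  classical
  exact (Finset.mem_filter.1 (R.push.mem _ _ _ h)).2

theorem owner_inj {b b' : Fin m} {v : V} (h : R.owner b = some v) (h' : R.owner b' = some v) :
    b = b' := R.push.inj _ _ _ _ h h'

theorem exists_owner (hdeg : m ≤ R.sourceNbrs.card) (b : Fin m) : ∃ v, R.owner b = some v :=
  Option.isSome_iff_exists.1 (R.push.complete _ hdeg b)

/-- The senders in the three steps are the source, owners and relays, which are disjoint classes,
and every transmission follows the direction of its link. A link therefore serves in one step only.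
Within a step the bit is determined by the recipient (push step 1), by the sender (push step 2), or
by injectivity of the matching (pull step 2). -/
theorem succeeds_of_matching (hO : R.Oriented)
    (hmatch : ∀ v, v ≠ R.source → ∃ f : Fin m → V,
      Set.InjOn f (R.needed v : Set (Fin m)) ∧ ∀ b ∈ R.needed v, b ∈ R.offers v (f b)) :
    R.Succeeds := by
  classical
  have hpush2 : ∀ {u v b}, R.Push2 u v b → u ≠ R.source := fun h e =>
    R.links.ne_of_adj (adj_of_owner h.1) e.symm
  have hpull : ∀ {u v b}, R.Pull2 u v b → R.IsRelay u ∧ R.dir u v ∧ R.Has2 u b := fun h =>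
    (Finset.mem_filter.1 ((R.pull _).sound _ _ _ _ h).2).2
  refine ⟨fun v b => ?_, ?_, ?_⟩
  · by_cases hb : R.Has2 v b
    · exact Or.inl hb
    · have hv : v ≠ R.source := fun e => hb (Or.inl (Or.inl e))
      have hs := (R.pull v).complete _ _ (hmatch v hv) b (by simpa [needed] using hb)
      exact Or.inr (Option.isSome_iff_exists.1 hs)
  · rintro (_ | _ | _) u v b h
    · obtain ⟨rfl, h⟩ := h
      exact ⟨adj_of_owner h, hO.source _ (adj_of_owner h), rfl⟩
    · exact ⟨hO.adj _ _ h.2, h.2, Or.inr ⟨R.source, rfl, h.1⟩⟩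
    · obtain ⟨-, h1, h2⟩ := hpull h
      exact ⟨hO.adj _ _ h1, h1, h2⟩
  · have hdir : ∀ {k u v b}, R.Sent k u v b → R.dir u v := by
      rintro (_ | _ | _) u v b h
      · obtain ⟨rfl, h⟩ := h
        exact hO.source _ (adj_of_owner h)
      · exact h.2
      · exact (hpull h).2.1
    intro k u v b k' u' v' b' h h' he
    obtain ⟨rfl, rfl⟩ : u = u' ∧ v = v' := by
      rcases Sym2.eq_iff.1 he with e | ⟨rfl, rfl⟩
      · exact e
      · exact absurd (hdir h') (hO.asymm _ _ (hdir h))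
    suffices k = k' ∧ b = b' from ⟨this.1, rfl, rfl, this.2⟩
    rcases k with _ | _ | _ <;> rcases k' with _ | _ | _
    · exact ⟨rfl, owner_inj h.2 h'.2⟩
    · exact absurd h.1 (hpush2 h')
    · exact absurd h.1 (hpull h').1.1
    · exact absurd h'.1 (hpush2 h)
    · exact ⟨rfl, owner_inj h.1 h'.1⟩
    · exact absurd h.1 ((hpull h').1.2 b)
    · exact absurd h'.1 (hpull h).1.1
    · exact absurd h'.1 ((hpull h).1.2 b')
    · exact ⟨rfl, (R.pull v).inj _ _ _ _ _ h h'⟩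

/-- The tree of the bit `b` joins each node to a node that sent `b` to it; the single use of links
makes these trees edge-disjoint. -/
theorem Succeeds.packsSpanningTrees (hR : R.Succeeds) :
    PacksSpanningTrees R.links R.source m 3 := by
  classical
  obtain ⟨hall, hsent, huniq⟩ := hR
  -- The rank is the hop at which `b` reaches `v`. It drops from a node to its parent, which rules
  -- out cycles, and bounds the depth.
  let rank : Fin m → V → ℕ := fun b v =>
    if v = R.source then 0 else if R.owner b = some v then 1 else
      if ∃ u, R.Push2 u v b then 2 else 3
  have rank_source : ∀ b, rank b R.source = 0 := fun b => if_pos rfl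
  have rank_owner : ∀ {b v}, R.owner b = some v → rank b v ≤ 1 := by
    intro b v h
    simp only [rank, if_pos h]
    split_ifs <;> omega
  have rank_le_two : ∀ {b v}, R.Has2 v b → rank b v ≤ 2 := by
    rintro b v ((h | ⟨u, -, h⟩) | h)
    · rw [show v = R.source from h, rank_source]
      omega
    · exact (rank_owner h).trans one_le_two
    · simp only [rank, if_pos h]
      split_ifs <;> omega
  have rank_le : ∀ b v, rank b v ≤ 3 := by
    intro b v
    simp only [rank]
    split_ifs <;> omega
  have key : ∀ b v, ∃ u, v ≠ R.source → (∃ k, R.Sent k u v b) ∧ rank b u < rank b v := by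
    intro b v
    by_cases hv : v = R.source
    · exact ⟨v, fun h => absurd hv h⟩
    by_cases h1 : R.owner b = some v
    · refine ⟨R.source, fun _ => ⟨⟨.push1, rfl, h1⟩, ?_⟩⟩
      rw [rank_source]
      simp [rank, hv, h1]
    by_cases h2 : ∃ u, R.Push2 u v b
    · obtain ⟨u, hu⟩ := id h2
      refine ⟨u, fun _ => ⟨⟨.push2, hu⟩, (rank_owner hu.1).trans_lt ?_⟩⟩
      simp [rank, hv, h1, h2]
    · have h3 : ∃ u, R.Pull2 u v b := by
        rcases hall v b with ((h | ⟨u, -, h⟩) | h) | h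
        · exact absurd h hv
        · exact absurd h h1
        · exact absurd h h2
        · exact h
      obtain ⟨u, hu⟩ := h3
      refine ⟨u, fun _ => ⟨⟨.pull2, hu⟩, (rank_le_two (hsent .pull2 u v b hu).2.2).trans_lt ?_⟩⟩
      simp [rank, hv, h1, h2]
  choose parent hparent using key
  have hrank : ∀ b v, v ≠ R.source → rank b (parent b v) < rank b v := fun b v hv =>
    (hparent b v hv).2
  have hedge : ∀ {b u v}, (parentGraph R.source (parent b)).Adj u v →
      ∃ k x y, R.Sent k x y b ∧ s(x, y) = s(u, v) := by
    intro b u v h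
    rcases ((SimpleGraph.fromRel_adj _ _ _).1 h).2 with ⟨hu, rfl⟩ | ⟨hv, rfl⟩
    · obtain ⟨k, hk⟩ := (hparent b u hu).1
      exact ⟨k, _, _, hk, Sym2.eq_swap⟩
    · obtain ⟨k, hk⟩ := (hparent b v hv).1
      exact ⟨k, _, _, hk, rfl⟩
  refine ⟨fun b => parentGraph R.source (parent b), fun b => ⟨?_, parentGraph_isTree (hrank b),
    fun v => (parentGraph_dist_le (hrank b) v).trans (rank_le b v)⟩, fun b b' hb => ?_⟩
  · intro u v h
    obtain ⟨k, x, y, hs, he⟩ := hedge h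
    rw [← SimpleGraph.mem_edgeSet, ← he]
    exact (hsent _ _ _ _ hs).1
  · refine Set.disjoint_left.2 fun e => ?_
    induction e using Sym2.ind with
    | _ u v =>
      intro h h'
      obtain ⟨k, x, y, hs, he⟩ := hedge h
      obtain ⟨k', x', y', hs', he'⟩ := hedge h'
      exact hb (huniq _ _ _ _ _ _ _ _ hs hs' (he.trans he'.symm)).2.2.2

/-- The number of needed bits plus the surplus of in-neighbours over bits bounds the number of
helper relays from below. -/
theorem card_needed_add_le {v : V} {d : ℕ} (hin : m + d ≤ (R.inNbrs v).card) :
    (R.needed v).card + d ≤ (R.inRelays v).card := by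
  classical
  -- Bits delivered directly by their owners: each one reduces the needed bits by one, and accounts
  -- for the loss of at most one relay among the in-neighbours.
  let P : Finset (Fin m) := Finset.univ.filter fun b => ∃ o, R.owner b = some o ∧ R.dir o v
  have h1 : (R.needed v).card + P.card ≤ m := by
    rw [← Finset.card_union_of_disjoint]
    · simpa using Finset.card_le_univ (R.needed v ∪ P)
    · refine Finset.disjoint_left.2 fun b hb hb' => ?_
      obtain ⟨o, ho⟩ := (Finset.mem_filter.1 hb').2
      exact (Finset.mem_filter.1 hb).2 (Or.inr ⟨o, ho⟩)
  have h2 : ((R.inNbrs v).filter fun u => ¬ R.IsRelay u) ⊆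
      P.image fun b => (R.owner b).getD R.source := by
    intro u hu
    obtain ⟨hu, hr⟩ := Finset.mem_filter.1 hu
    obtain ⟨hu, huv⟩ := mem_inNbrs.1 hu
    obtain ⟨b, hb⟩ : ∃ b, R.owner b = some u := by
      by_contra! h
      exact hr ⟨hu, h⟩
    exact Finset.mem_image.2 ⟨b, Finset.mem_filter.2 ⟨Finset.mem_univ _, u, hb, huv⟩, by simp [hb]⟩
  have h3 := (Finset.card_le_card h2).trans Finset.card_image_le
  have h4 := Finset.card_filter_add_card_filter_not (s := R.inNbrs v) R.IsRelay
  rw [inRelays]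
  omega

/-- Hall's theorem. The expansion hypothesis concerns arbitrary sets `U` no larger than `S`, not the
random neighbourhood of `S`, so that a union bound over fixed pairs `(S, U)` can establish it. -/
theorem exists_matching [DecidableEq V] {v : V} {d : ℕ}
    (hin : m + d ≤ (R.inNbrs v).card)
    (hexp : ∀ (S : Finset (Fin m)) (U : Finset V), S.Nonempty → (∀ b ∈ S, R.owner b ≠ some v) →
      U.card ≤ S.card → d ≤ (R.inRelays v \ U).card →
      ∃ b ∈ S, ∃ r ∈ R.inRelays v \ U, ∃ o, R.owner b = some o ∧ R.dir o r) :
    ∃ f : Fin m → V,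
      Set.InjOn f (R.needed v : Set (Fin m)) ∧ ∀ b ∈ R.needed v, b ∈ R.offers v (f b) := by
  classical
  let t : {b // b ∈ R.needed v} → Finset V := fun b => Finset.univ.filter fun r => b.1 ∈ R.offers v r
  have hall : ∀ s : Finset {b // b ∈ R.needed v}, s.card ≤ (s.biUnion t).card := by
    intro s
    by_contra! hlt
    let S : Finset (Fin m) := s.map (Function.Embedding.subtype _)
    have hS : S.card = s.card := Finset.card_map _
    have hSn : S ⊆ R.needed v := by
      intro b hb
      obtain ⟨x, -, rfl⟩ := Finset.mem_map.1 hb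
      exact x.2
    -- With `|U| < |S| ≤ |needed|`, the surplus `d` leaves at least `d` relays outside `U =
    -- s.biUnion t`.
    have h1 := card_needed_add_le hin
    have h2 := Finset.le_card_sdiff (s.biUnion t) (R.inRelays v)
    have h3 := Finset.card_le_card hSn
    obtain ⟨b, hb, r, hr, o, ho, hor⟩ := hexp S (s.biUnion t)
      (Finset.card_pos.1 (by omega))
      (fun b hb hbv => (Finset.mem_filter.1 (hSn hb)).2 (Or.inl (Or.inr ⟨_, rfl, hbv⟩)))
      (by omega) (by omega)
    obtain ⟨hr, hrU⟩ := Finset.mem_sdiff.1 hr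
    obtain ⟨hrel, hrv⟩ := mem_inRelays.1 hr
    obtain ⟨x, hx, rfl⟩ := Finset.mem_map.1 hb
    refine hrU (Finset.mem_biUnion.2 ⟨x, hx, Finset.mem_filter.2 ⟨Finset.mem_univ _,
      Finset.mem_filter.2 ⟨Finset.mem_univ _, hrel, hrv,
        Or.inr ⟨o, ho, hor⟩⟩⟩⟩)
  obtain ⟨f, hf, hft⟩ := (Finset.all_card_le_biUnion_card_iff_exists_injective t).1 hall
  refine ⟨fun b => if h : b ∈ R.needed v then f ⟨b, h⟩ else v, ?_, ?_⟩
  · intro b hb b' hb' h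
    have hb : b ∈ R.needed v := hb
    have hb' : b' ∈ R.needed v := hb'
    simp only [dif_pos hb, dif_pos hb'] at h
    exact congrArg Subtype.val (hf h)
  · intro b hb
    simp only [dif_pos hb]
    exact (Finset.mem_filter.1 (hft ⟨b, hb⟩)).2

end Run

end Allcast

namespace Allcast

/-! ### Concentration and decoupling -/

section General

variable {Ω : Type*} {mΩ : MeasurableSpace Ω} {μ : Measure Ω} [IsProbabilityMeasure μ]

open Classical in
/-- Hoeffding's inequality for the lower tail of the number of independent events that occur. -/
theorem measureReal_card_le_exp {ι : Type*} [Fintype ι] {E : ι → Set Ω}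
    (hE : ∀ i, MeasurableSet (E i)) (hi : iIndepSet E μ) {q : ℝ} (hq : ∀ i, μ.real (E i) = q)
    {t : ℝ} (ht : 0 ≤ t) :
    μ.real {ω | ((Finset.univ.filter fun i => ω ∈ E i).card : ℝ) ≤ Fintype.card ι * q - t} ≤
      Real.exp (-(2 * t ^ 2 / Fintype.card ι)) := by
  let X : ι → Ω → ℝ := fun i => (fun x => q - x) ∘ (E i).indicator fun _ => 1
  have hX : iIndepFun X μ :=
    (iIndepSet.iIndepFun_indicator (β := ℝ) hi).comp (fun _ x => q - x) fun _ => by fun_prop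
  -- Hoeffding's lemma: `X i` is centred with values in `[q - 1, q]`, an interval of length 1, so
  -- the variance proxy is `(1/2)^2`.
  have hsub : ∀ i ∈ (Finset.univ : Finset ι), HasSubgaussianMGF (X i) (1 / 4) μ := by
    intro i _
    have hm : Measurable (X i) := (measurable_const.sub measurable_id).comp
      (measurable_const.indicator (hE i))
    have h := hasSubgaussianMGF_of_mem_Icc_of_integral_eq_zero (μ := μ) (X := X i) (a := q - 1)
      (b := q) hm.aemeasurable ?_ ?_
    · have h4 : ((‖q - (q - 1)‖₊ / 2) ^ 2 : NNReal) = 1 / 4 := by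
        ext
        simp
        norm_num
      rwa [h4] at h
    · refine Eventually.of_forall fun ω => ?_
      by_cases hω : ω ∈ E i <;> simp [X, hω]
    · have : ∫ ω, X i ω ∂μ = ∫ ω, q - (E i).indicator (fun _ => (1 : ℝ)) ω ∂μ := rfl
      rw [this, integral_sub (integrable_const _) ((integrable_const _).indicator (hE i)),
        integral_indicator_const _ (hE i), hq]
      simp
  have h := HasSubgaussianMGF.measure_sum_ge_le_of_iIndepFun hX hsub ht
  have hsum : ∀ ω, ∑ i, X i ω =
      Fintype.card ι * q - (Finset.univ.filter fun i => ω ∈ E i).card := by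
    intro ω
    simp only [X, Function.comp_apply, Finset.sum_sub_distrib, Set.indicator_apply,
      Finset.sum_boole, Finset.sum_const, Finset.card_univ, nsmul_eq_mul]
  refine (le_of_eq ?_).trans (h.trans (le_of_eq ?_))
  · congr 1
    ext ω
    simp only [Set.mem_ofPred_eq, hsum]
    exact le_sub_comm
  · congr 1
    simp only [Finset.sum_const, Finset.card_univ, nsmul_eq_mul]
    push_cast
    by_cases h0 : (Fintype.card ι : ℝ) = 0
    · simp [h0]
    · field_simp
      ring

theorem measureReal_iInter_compl_le_exp {ι : Type*} [Fintype ι] {E : ι → Set Ω}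
    (hE : ∀ i, MeasurableSet (E i)) (hi : iIndepSet E μ) {q : ℝ} (hq : ∀ i, μ.real (E i) = q) :
    μ.real (⋂ i, (E i)ᶜ) ≤ Real.exp (-(q * Fintype.card ι)) := by
  have h : μ (⋂ i, (E i)ᶜ) = ∏ i, μ (E i)ᶜ := ((iIndepSet_iff_iIndep _ _).1 hi).meas_iInter fun i =>
    (MeasurableSpace.measurableSet_generateFrom (Set.mem_singleton _)).compl
  have h' : ∀ i, μ.real (E i)ᶜ = 1 - q := fun i => by rw [probReal_compl_eq_one_sub (hE i), hq]
  have h1 : μ.real (⋂ i, (E i)ᶜ) = ∏ i, μ.real (E i)ᶜ := by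
    simp only [Measure.real, h, ENNReal.toReal_prod]
  rw [h1]
  calc ∏ i, μ.real (E i)ᶜ ≤ ∏ _i : ι, Real.exp (-q) := by
        refine Finset.prod_le_prod (fun _ _ => measureReal_nonneg) fun i _ => ?_
        rw [h']
        linarith [Real.add_one_le_exp (-q)]
    _ = Real.exp (-(q * Fintype.card ι)) := by
        rw [Finset.prod_const, ← Real.exp_nat_mul, Finset.card_univ]
        congr 1
        ring

/-- If the events `G a` are independent of the finite-valued variable `F`, a bound on their
probabilities is a bound on the probability of `G (F ω)`. -/
theorem measureReal_mem_comp_le {α : Type*} [Fintype α] {m₁ m₂ : MeasurableSpace Ω}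
    (hle : m₁ ≤ mΩ) (hind : Indep m₁ m₂ μ) {F : Ω → α}
    (hF : ∀ a, MeasurableSet[m₁] (F ⁻¹' {a})) {G : α → Set Ω}
    (hG : ∀ a, MeasurableSet[m₂] (G a)) {δ : ℝ} (hδ : ∀ a, μ.real (G a) ≤ δ) :
    μ.real {ω | ω ∈ G (F ω)} ≤ δ := by
  -- Splitting by the value of `F` replaces conditioning on it.
  have hsub : {ω | ω ∈ G (F ω)} ⊆ ⋃ a, F ⁻¹' {a} ∩ G a := fun ω hω =>
    Set.mem_iUnion.2 ⟨F ω, rfl, hω⟩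
  have hone : ∑ a, μ.real (F ⁻¹' {a}) = 1 := by
    have := measureReal_biUnion_finset (μ := μ) (s := (Finset.univ : Finset α))
      (f := fun a => F ⁻¹' {a})
      (fun a _ b _ hab => Set.disjoint_left.2 fun ω h h' => hab (h.symm.trans h'))
      (fun a _ => hle _ (hF a))
    rw [← this]
    have : (⋃ a ∈ (Finset.univ : Finset α), F ⁻¹' {a}) = Set.univ := by
      ext
      simp
    rw [this, probReal_univ]
  calc μ.real {ω | ω ∈ G (F ω)} ≤ μ.real (⋃ a, F ⁻¹' {a} ∩ G a) := measureReal_mono hsub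
    _ ≤ ∑ a, μ.real (F ⁻¹' {a} ∩ G a) := measureReal_iUnion_fintype_le _
    _ = ∑ a, μ.real (F ⁻¹' {a}) * μ.real (G a) := by
        refine Finset.sum_congr rfl fun a _ => ?_
        simp only [Measure.real, (Indep_iff _ _ μ).1 hind _ _ (hF a) (hG a), ENNReal.toReal_mul]
    _ ≤ ∑ a, μ.real (F ⁻¹' {a}) * δ :=
        Finset.sum_le_sum fun a _ => mul_le_mul_of_nonneg_left (hδ a) measureReal_nonneg
    _ = δ := by rw [← Finset.sum_mul, hone, one_mul]

theorem measurableSet_filter_eq {V : Type*} [Fintype V] {m : MeasurableSpace Ω}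
    {P : Ω → V → Prop} [∀ ω, DecidablePred (P ω)] (hP : ∀ v, MeasurableSet[m] {ω | P ω v}) (N : Finset V) :
    MeasurableSet[m] {ω | Finset.univ.filter (P ω) = N} := by
  have : {ω | Finset.univ.filter (P ω) = N} = ⋂ v, {ω | P ω v ↔ v ∈ N} := by
    ext ω
    simp [Finset.ext_iff]
  rw [this]
  refine MeasurableSet.iInter fun v => ?_
  by_cases hv : v ∈ N
  · simpa [hv] using hP v
  · have : {ω | P ω v ↔ v ∈ N} = {ω | P ω v}ᶜ := by
      ext
      simp [hv]
    rw [this]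
    exact (hP v).compl

end General

/-- The link between two distinct nodes (a dummy value if they are equal). -/
def link (u v : ℕ) : Link :=
  if h : u < v then ⟨(u, v), h⟩ else if h : v < u then ⟨(v, u), h⟩ else ⟨(0, 1), one_pos⟩

theorem link_eq_link {u v u' v' : ℕ} (h : u ≠ v) (h' : u' ≠ v') (e : link u v = link u' v') :
    (u = u' ∧ v = v') ∨ (u = v' ∧ v = u') := by
  unfold link at e
  split_ifs at e <;> simp only [Subtype.mk.injEq, Prod.mk.injEq] at e <;> omega

theorem link_fst_or {u v : ℕ} (h : u ≠ v) :
    ((link u v).1.1 = u ∧ (link u v).1.2 = v) ∨ ((link u v).1.1 = v ∧ (link u v).1.2 = u) := by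
  unfold link
  split_ifs
  · simp
  · simp
  · omega

/-! ### Directed links in terms of capacities and coins -/

section Orientation

variable {n : ℕ} {c d : Link → Bool}

/-- Away from the source a directed link prescribes one capacity and one coin of the same link. This
gives probability `p/2`, and independence for different links. -/
theorem orient_iff {u v : Fin (n + 1)} (hu : u ≠ 0) (hv : v ≠ 0) (huv : u ≠ v) :
    orient n c d u v ↔ c (link u v) = true ∧ d (link u v) = decide ((u : ℕ) < v) := by
  have huv' : (u : ℕ) ≠ v := fun e => huv (Fin.ext e)
  rcases lt_or_gt_of_ne huv' with h | h
  · simp [orient, link, h, hu, h.not_gt]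
  · simp [orient, link, h, hv, h.not_gt]

theorem not_orient_self (u : Fin (n + 1)) : ¬ orient n c d u u := by
  simp [orient]

theorem graph_zero_adj_iff {v : Fin (n + 1)} (hv : v ≠ 0) :
    (graph n c).Adj 0 v ↔ c (link 0 v) = true := by
  have h : 0 < (v : ℕ) := Nat.pos_of_ne_zero fun e => hv (Fin.ext e)
  simp [graph, SimpleGraph.fromRel_adj, link, h, hv.symm, Fin.pos_iff_ne_zero, hv]

/-- The neighbours of the source, and the nodes other than the source with a link to `j`. -/
noncomputable def nbrs (n : ℕ) (c d : Link → Bool) (j : Fin (n + 1)) :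
    Finset (Fin (n + 1)) × Finset (Fin (n + 1)) := by
  classical
  exact (Finset.univ.filter fun v => (graph n c).Adj 0 v,
    Finset.univ.filter fun u => u ≠ 0 ∧ orient n c d u j)

theorem allcast_oriented {m : ℕ} (push : PushRule (Fin (n + 1)) m)
    (pull : Fin (n + 1) → PullRule (Fin (n + 1)) m) : (allcast n c d push pull).Oriented where
  adj := by
    rintro u v (⟨h, hc, -⟩ | ⟨h, hc, -⟩)
    · exact (SimpleGraph.fromRel_adj _ _ _).2 ⟨fun e => by simp [e] at h, Or.inl ⟨h, hc⟩⟩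
    · exact (SimpleGraph.fromRel_adj _ _ _).2 ⟨fun e => by simp [e] at h, Or.inr ⟨h, hc⟩⟩
  asymm := by
    rintro u v (⟨h, -, h1⟩ | ⟨h, -, h1, h2⟩) (⟨h', -, h3⟩ | ⟨h', -, h3, h4⟩)
    · omega
    · rcases h1 with h1 | h1
      · exact h3 h1
      · rw [h1] at h4
        cases h4
    · rcases h3 with h3 | h3
      · exact h1 h3
      · rw [h3] at h2
        cases h2
    · omega
  source := by
    intro v hv
    obtain ⟨hne, ⟨h, hc⟩ | ⟨h, hc⟩⟩ := (SimpleGraph.fromRel_adj _ _ _).1 hv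
    · exact Or.inl ⟨h, hc, Or.inl rfl⟩
    · exact absurd h (Nat.not_lt_zero _)

end Orientation

end Allcast

/-! ### Probability estimates in the random model -/

namespace Allcast

variable {Ω : Type*} [mΩ : MeasurableSpace Ω] {μ : Measure Ω} [IsProbabilityMeasure μ]
  {p : ℝ} {C D : Link → Ω → Bool} {n : ℕ}

/-- The capacities are Bernoulli with parameter `p`, the direction coins are fair, and all of them
are independent. -/
structure IsModel (μ : Measure Ω) (p : ℝ) (C D : Link → Ω → Bool) : Prop where
  measurable_C : ∀ e, Measurable (C e)
  measurable_D : ∀ e, Measurable (D e)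
  prob_C : ∀ e, μ.real (C e ⁻¹' {true}) = p
  prob_D : ∀ e b, μ.real (D e ⁻¹' {b}) = 1 / 2
  indep : iIndepFun (Sum.elim C D) μ

namespace IsModel

omit [IsProbabilityMeasure μ] in
theorem measurableSet_C (h : IsModel μ p C D) (e : Link) (b : Bool) :
    MeasurableSet (C e ⁻¹' {b}) := h.measurable_C e (measurableSet_singleton _)

omit [IsProbabilityMeasure μ] in
theorem measurableSet_D (h : IsModel μ p C D) (e : Link) (b : Bool) :
    MeasurableSet (D e ⁻¹' {b}) := h.measurable_D e (measurableSet_singleton _)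

omit [IsProbabilityMeasure μ] in
theorem iIndepSet_C (h : IsModel μ p C D) {ι : Type*} {e : ι → Link} (he : e.Injective) :
    iIndepSet (fun i => C (e i) ⁻¹' {true}) μ := by
  rw [iIndepSet_iff_meas_biInter fun i => h.measurableSet_C _ _]
  intro s
  exact (h.indep.precomp (g := fun i => Sum.inl (e i)) (Sum.inl_injective.comp he)).meas_biInter
    fun i _ => ⟨{true}, measurableSet_singleton _, rfl⟩

omit [IsProbabilityMeasure μ] in
-- Joint independence of capacities and coins, applied to the index set `s.disjSum s`, which lists
-- each link once for its capacity and once for its coin.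
theorem meas_biInter (h : IsModel μ p C D) {ι : Type*} {e : ι → Link} (he : e.Injective)
    (b : ι → Bool) (s : Finset ι) :
    μ (⋂ i ∈ s, C (e i) ⁻¹' {true} ∩ D (e i) ⁻¹' {b i}) =
      ∏ i ∈ s, μ (C (e i) ⁻¹' {true}) * μ (D (e i) ⁻¹' {b i}) := by
  have hinj : Function.Injective (Sum.map e e) := Sum.map_injective.2 ⟨he, he⟩
  have hX := (h.indep.precomp hinj).meas_biInter (S := s.disjSum s)
    (s := Sum.elim (fun i => C (e i) ⁻¹' {true}) fun i => D (e i) ⁻¹' {b i})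
    (by
      rintro (i | i) -
      · exact ⟨{true}, measurableSet_singleton _, rfl⟩
      · exact ⟨{b i}, measurableSet_singleton _, rfl⟩)
  rw [Finset.prod_disjSum] at hX
  simp only [Sum.elim_inl, Sum.elim_inr] at hX
  rw [Finset.prod_mul_distrib, ← hX]
  congr 1
  ext ω
  simp only [Set.mem_iInter, Finset.mem_disjSum, Set.mem_inter_iff]
  constructor
  · rintro hω _ (⟨i, hi, rfl⟩ | ⟨i, hi, rfl⟩)
    · exact (hω i hi).1
    · exact (hω i hi).2
  · intro hω i hi
    exact ⟨hω (Sum.inl i) (Or.inl ⟨i, hi, rfl⟩), hω (Sum.inr i) (Or.inr ⟨i, hi, rfl⟩)⟩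

omit [IsProbabilityMeasure μ] in
theorem meas_inter (h : IsModel μ p C D) (e : Link) (b : Bool) :
    μ (C e ⁻¹' {true} ∩ D e ⁻¹' {b}) = μ (C e ⁻¹' {true}) * μ (D e ⁻¹' {b}) := by
  have := h.meas_biInter (e := fun _ : Unit => e) (fun _ _ _ => rfl) (fun _ => b) {()}
  simpa [Set.iInter_const] using this

omit [IsProbabilityMeasure μ] in
theorem measureReal_inter (h : IsModel μ p C D) (e : Link) (b : Bool) :
    μ.real (C e ⁻¹' {true} ∩ D e ⁻¹' {b}) = p / 2 := by
  have h1 := h.prob_C e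
  have h2 := h.prob_D e b
  simp only [Measure.real] at h1 h2 ⊢
  rw [h.meas_inter, ENNReal.toReal_mul, h1, h2]
  ring

omit [IsProbabilityMeasure μ] in
theorem iIndepSet_inter (h : IsModel μ p C D) {ι : Type*} {e : ι → Link} (he : e.Injective)
    (b : ι → Bool) : iIndepSet (fun i => C (e i) ⁻¹' {true} ∩ D (e i) ⁻¹' {b i}) μ := by
  rw [iIndepSet_iff_meas_biInter fun i => (h.measurableSet_C _ _).inter (h.measurableSet_D _ _)]
  intro s
  rw [h.meas_biInter he]
  exact Finset.prod_congr rfl fun i _ => (h.meas_inter _ _).symm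

omit mΩ in
/-- The event that the link `{u, v}` is present and directed from `u` to `v`, for distinct nodes
`u, v` other than the source. -/
theorem setOf_orient_eq {u v : Fin (n + 1)} (hu : u ≠ 0) (hv : v ≠ 0) (huv : u ≠ v) :
    {ω | orient n (fun e => C e ω) (fun e => D e ω) u v} =
      C (link u v) ⁻¹' {true} ∩ D (link u v) ⁻¹' {decide ((u : ℕ) < v)} := by
  ext ω
  exact orient_iff (c := fun e => C e ω) (d := fun e => D e ω) hu hv huv

open Classical in
theorem measureReal_card_sourceNbrs_le (h : IsModel μ p C D) {t : ℝ} (ht : 0 ≤ t) :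
    μ.real {ω | ((Finset.univ.filter fun v : Fin (n + 1) =>
        (graph n fun e => C e ω).Adj 0 v).card : ℝ) ≤ n * p - t} ≤
      Real.exp (-(2 * t ^ 2 / n)) := by
  let ι := {v : Fin (n + 1) // v ≠ 0}
  have hinj : Function.Injective fun v : ι => link 0 v := by
    intro v v' he
    have hv : (0 : ℕ) ≠ (v : Fin (n + 1)) := fun e => v.2 (Fin.ext e.symm)
    have hv' : (0 : ℕ) ≠ (v' : Fin (n + 1)) := fun e => v'.2 (Fin.ext e.symm)
    rcases link_eq_link hv hv' he with ⟨-, e⟩ | ⟨e, -⟩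
    · exact Subtype.ext (Fin.ext e)
    · exact absurd e hv'
  have hcard : Fintype.card ι = n := by
    simp [ι]
  have := measureReal_card_le_exp (fun v : ι => h.measurableSet_C (link 0 v) true)
    (h.iIndepSet_C hinj) (fun v => h.prob_C _) ht
  rw [hcard] at this
  refine (measureReal_mono ?_).trans this
  intro ω hω
  simp only [Set.mem_ofPred_eq] at hω ⊢
  refine le_trans (Nat.cast_le.2 ?_) hω
  refine Finset.card_le_card_of_injOn Subtype.val ?_ Subtype.val_injective.injOn
  intro v hv
  have hv := (Finset.mem_filter.1 hv).2
  exact Finset.mem_coe.2 (Finset.mem_filter.2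
    ⟨Finset.mem_univ _, (graph_zero_adj_iff v.2).2 hv⟩)

open Classical in
theorem measureReal_card_inNbrs_le (h : IsModel μ p C D) {j : Fin (n + 1)} (hj : j ≠ 0) {t : ℝ}
    (ht : 0 ≤ t) :
    μ.real {ω | ((Finset.univ.filter fun u : Fin (n + 1) =>
        u ≠ 0 ∧ orient n (fun e => C e ω) (fun e => D e ω) u j).card : ℝ) ≤
          (n - 1 : ℕ) * (p / 2) - t} ≤ Real.exp (-(2 * t ^ 2 / (n - 1 : ℕ))) := by
  let ι := {u : Fin (n + 1) // u ∈ ({0, j} : Finset (Fin (n + 1)))ᶜ}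
  have h0 : ∀ u : ι, u.1 ≠ 0 := fun u e => by simpa [e] using u.2
  have h1 : ∀ u : ι, u.1 ≠ j := fun u e => by simpa [e] using u.2
  have h1' : ∀ u : ι, (u.1 : ℕ) ≠ j := fun u e => h1 u (Fin.ext e)
  have hinj : Function.Injective fun u : ι => link u.1 j := by
    intro u u' he
    rcases link_eq_link (h1' u) (h1' u') he with ⟨e, -⟩ | ⟨e, -⟩
    · exact Subtype.ext (Fin.ext e)
    · exact absurd e (h1' u)
  have hcard : Fintype.card ι = n - 1 := by
    rw [Fintype.card_coe, Finset.card_compl, Finset.card_pair hj.symm, Fintype.card_fin]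
    omega
  have := measureReal_card_le_exp
    (fun u : ι => (h.measurableSet_C (link u.1 j) true).inter
      (h.measurableSet_D (link u.1 j) (decide ((u.1 : ℕ) < j))))
    (h.iIndepSet_inter hinj _) (fun u => h.measureReal_inter _ _) ht
  rw [hcard] at this
  refine (measureReal_mono ?_).trans this
  intro ω hω
  simp only [Set.mem_ofPred_eq] at hω ⊢
  refine le_trans (Nat.cast_le.2 ?_) hω
  refine Finset.card_le_card_of_injOn Subtype.val ?_ Subtype.val_injective.injOn
  intro u hu
  have hu := ((@Finset.mem_filter _ _ (_) _ _).1 hu).2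
  exact Finset.mem_coe.2 (Finset.mem_filter.2
    ⟨Finset.mem_univ _, h0 u, (orient_iff (h0 u) hj (h1 u)).2 hu⟩)

/-- Two disjoint sets of nodes other than the source are unlikely to have no link from the
first to the second. -/
theorem measureReal_no_orient_le (h : IsModel μ p C D) {S T : Finset (Fin (n + 1))}
    (hS : 0 ∉ S) (hT : 0 ∉ T) (hST : Disjoint S T) :
    μ.real {ω | ∀ u ∈ S, ∀ r ∈ T, ¬ orient n (fun e => C e ω) (fun e => D e ω) u r} ≤
      Real.exp (-(p / 2 * (S.card * T.card))) := by
  let ι := S × T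
  have hne : ∀ x : ι, x.1.1 ≠ x.2.1 := fun x e =>
    Finset.disjoint_left.1 hST x.1.2 (e ▸ x.2.2)
  have hne' : ∀ x : ι, (x.1.1 : ℕ) ≠ x.2.1 := fun x e => hne x (Fin.ext e)
  have h0 : ∀ x : ι, x.1.1 ≠ 0 := fun x e => hS (e ▸ x.1.2)
  have h0' : ∀ x : ι, x.2.1 ≠ 0 := fun x e => hT (e ▸ x.2.2)
  -- Disjointness of `S` and `T` excludes that two pairs are reversals of each other and so share a
  -- link.
  have hinj : Function.Injective fun x : ι => link x.1.1 x.2.1 := by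
    intro x y he
    rcases link_eq_link (hne' x) (hne' y) he with ⟨e, e'⟩ | ⟨e, -⟩
    · exact Prod.ext (Subtype.ext (Fin.ext e)) (Subtype.ext (Fin.ext e'))
    · exact absurd (Fin.ext e ▸ y.2.2) (Finset.disjoint_left.1 hST x.1.2)
  have := measureReal_iInter_compl_le_exp
    (fun x : ι => (h.measurableSet_C (link x.1.1 x.2.1) true).inter
      (h.measurableSet_D (link x.1.1 x.2.1) (decide ((x.1.1 : ℕ) < x.2.1))))
    (h.iIndepSet_inter hinj _) (fun x => h.measureReal_inter _ _)
  rw [Fintype.card_prod, Fintype.card_coe, Fintype.card_coe, Nat.cast_mul] at this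
  refine (measureReal_mono ?_).trans this
  intro ω hω
  refine Set.mem_iInter.2 fun x => ?_
  rw [← setOf_orient_eq (h0 x) (h0' x) (hne x)]
  exact hω _ x.1.2 _ x.2.2

/-- The information carried by the capacities and coins with indices in `A`. -/
abbrev infoOn (C D : Link → Ω → Bool) (A : Set (Link ⊕ Link)) : MeasurableSpace Ω :=
  ⨆ x ∈ A, MeasurableSpace.comap (Sum.elim C D x) inferInstance

omit mΩ in
theorem measurableSet_infoOn {A : Set (Link ⊕ Link)} {x : Link ⊕ Link} (hx : x ∈ A) (b : Bool) :
    MeasurableSet[infoOn C D A] (Sum.elim C D x ⁻¹' {b}) :=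
  le_iSup₂ (f := fun x (_ : x ∈ A) => MeasurableSpace.comap (Sum.elim C D x) inferInstance) x hx _
    ⟨{b}, measurableSet_singleton _, rfl⟩

omit [IsProbabilityMeasure μ] in
theorem comap_le (h : IsModel μ p C D) (x : Link ⊕ Link) :
    MeasurableSpace.comap (Sum.elim C D x) inferInstance ≤ mΩ := by
  rcases x with e | e
  · exact (h.measurable_C e).comap_le
  · exact (h.measurable_D e).comap_le

/-- The indices of the capacities and coins of the links at one of the nodes `0` and `j`. -/
def touching (j : ℕ) : Set (Link ⊕ Link) :=
  {x | ∃ e : Link, (x = Sum.inl e ∨ x = Sum.inr e) ∧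
    (e.1.1 = 0 ∨ e.1.1 = j ∨ e.1.2 = 0 ∨ e.1.2 = j)}

theorem touching_link {j u v : ℕ} (huv : u ≠ v) (h : u = 0 ∨ u = j ∨ v = 0 ∨ v = j) :
    Sum.inl (link u v) ∈ touching j ∧ Sum.inr (link u v) ∈ touching j := by
  have : (link u v).1.1 = 0 ∨ (link u v).1.1 = j ∨ (link u v).1.2 = 0 ∨ (link u v).1.2 = j := by
    rcases link_fst_or huv with ⟨h1, h2⟩ | ⟨h1, h2⟩ <;> rw [h1, h2] <;> tauto
  exact ⟨⟨_, Or.inl rfl, this⟩, ⟨_, Or.inr rfl, this⟩⟩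

theorem not_touching_link {j u v : ℕ} (huv : u ≠ v) (h : ¬ (u = 0 ∨ u = j ∨ v = 0 ∨ v = j)) :
    Sum.inl (link u v) ∈ (touching j)ᶜ ∧ Sum.inr (link u v) ∈ (touching j)ᶜ := by
  have : ¬ ((link u v).1.1 = 0 ∨ (link u v).1.1 = j ∨ (link u v).1.2 = 0 ∨ (link u v).1.2 = j) := by
    rcases link_fst_or huv with ⟨h1, h2⟩ | ⟨h1, h2⟩ <;> rw [h1, h2] <;> tauto
  constructor
  · rintro ⟨e, he | he, h'⟩
    · cases he
      exact this h'
    · cases he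
  · rintro ⟨e, he | he, h'⟩
    · cases he
    · cases he
      exact this h'

omit mΩ in
theorem measurableSet_orient {A : Set (Link ⊕ Link)} {u v : Fin (n + 1)} (hu : u ≠ 0) (hv : v ≠ 0)
    (huv : u ≠ v) (h : Sum.inl (link u v) ∈ A ∧ Sum.inr (link u v) ∈ A) :
    MeasurableSet[infoOn C D A] {ω | orient n (fun e => C e ω) (fun e => D e ω) u v} := by
  rw [setOf_orient_eq hu hv huv]
  exact (measurableSet_infoOn h.1 _).inter (measurableSet_infoOn h.2 _)

omit mΩ in
theorem measurableSet_nbrs {j : Fin (n + 1)} (hj : j ≠ 0)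
    (a : Finset (Fin (n + 1)) × Finset (Fin (n + 1))) :
    MeasurableSet[infoOn C D (touching j)]
      ((fun ω => nbrs n (fun e => C e ω) (fun e => D e ω) j) ⁻¹' {a}) := by
  classical
  obtain ⟨N, I⟩ := a
  have h1 : MeasurableSet[infoOn C D (touching j)] {ω | Finset.univ.filter
      (fun v : Fin (n + 1) => (graph n fun e => C e ω).Adj 0 v) = N} := by
    refine measurableSet_filter_eq (m := infoOn C D (touching j)) (fun v => ?_) N
    by_cases hv : v = 0
    · simp [hv]
    · have : {ω | (graph n fun e => C e ω).Adj 0 v} = Sum.elim C D (Sum.inl (link 0 v)) ⁻¹' {true} := by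
        ext ω
        exact graph_zero_adj_iff (c := fun e => C e ω) hv
      rw [this]
      exact measurableSet_infoOn
        (touching_link (fun e => hv (Fin.ext e.symm)) (Or.inl rfl)).1 _
  have h2 : MeasurableSet[infoOn C D (touching j)] {ω | Finset.univ.filter
      (fun u : Fin (n + 1) => u ≠ 0 ∧ orient n (fun e => C e ω) (fun e => D e ω) u j) = I} := by
    refine measurableSet_filter_eq (m := infoOn C D (touching j)) (fun u => ?_) I
    by_cases hu : u = 0
    · simp [hu]
    by_cases huj : u = j
    · simp [huj, not_orient_self]
    · simp only [ne_eq, hu, not_false_eq_true, true_and]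
      exact measurableSet_orient hu hj huj
        (touching_link (fun e => huj (Fin.ext e)) (Or.inr (Or.inr (Or.inr rfl))))
  convert h1.inter h2 using 1
  ext ω
  simp only [Set.mem_preimage, Set.mem_singleton_iff, nbrs, Prod.mk.injEq]
  rfl

/-- The bound of `measureReal_no_orient_le` for sets of nodes that depend on the neighbours of the
source and on the links directed to `j`. -/
theorem measureReal_no_orient_nbrs_le (h : IsModel μ p C D) (hp : 0 ≤ p) {j : Fin (n + 1)}
    (hj : j ≠ 0)
    (S T : Finset (Fin (n + 1)) × Finset (Fin (n + 1)) → Finset (Fin (n + 1))) (s t : ℝ) :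
    μ.real {ω | ∀ a, nbrs n (fun e => C e ω) (fun e => D e ω) j = a →
      (0 ∉ S a ∧ 0 ∉ T a ∧ j ∉ S a ∧ j ∉ T a ∧ Disjoint (S a) (T a) ∧
        s * t ≤ (S a).card * (T a).card) ∧
      ∀ u ∈ S a, ∀ r ∈ T a, ¬ orient n (fun e => C e ω) (fun e => D e ω) u r} ≤
      Real.exp (-(p / 2 * (s * t))) := by
  classical
  -- For fixed `a` the side conditions are deterministic: if they fail, `G a` is empty; if they
  -- hold, `G a` involves only links that avoid `0` and `j`.
  let G : Finset (Fin (n + 1)) × Finset (Fin (n + 1)) → Set Ω := fun a =>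
    {ω | (0 ∉ S a ∧ 0 ∉ T a ∧ j ∉ S a ∧ j ∉ T a ∧ Disjoint (S a) (T a) ∧
        s * t ≤ (S a).card * (T a).card) ∧
      ∀ u ∈ S a, ∀ r ∈ T a, ¬ orient n (fun e => C e ω) (fun e => D e ω) u r}
  have hind : Indep (infoOn C D (touching j)) (infoOn C D (touching j)ᶜ) μ :=
    indep_iSup_of_disjoint h.comap_le h.indep.iIndep disjoint_compl_right
  have key := measureReal_mem_comp_le (iSup₂_le fun x _ => h.comap_le x) hind
    (F := fun ω => nbrs n (fun e => C e ω) (fun e => D e ω) j) (measurableSet_nbrs hj)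
    (G := G) (δ := Real.exp (-(p / 2 * (s * t)))) ?_ ?_
  · refine (measureReal_mono ?_).trans key
    exact fun ω hω => hω _ rfl
  · intro a
    by_cases ha : 0 ∉ S a ∧ 0 ∉ T a ∧ j ∉ S a ∧ j ∉ T a ∧ Disjoint (S a) (T a) ∧
        s * t ≤ (S a).card * (T a).card
    · have : G a = ⋂ u ∈ S a, ⋂ r ∈ T a,
          {ω | orient n (fun e => C e ω) (fun e => D e ω) u r}ᶜ := by
        ext ω
        simp only [G, Set.mem_iInter]
        exact ⟨fun h => h.2, fun h => ⟨ha, h⟩⟩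
      rw [this]
      refine @Finset.measurableSet_biInter _ _ (_) _ _ fun u hu =>
        @Finset.measurableSet_biInter _ _ (_) _ _ fun r hr => ?_
      obtain ⟨h1, h2, h3, h4, h5, -⟩ := ha
      have e1 : u ≠ 0 := fun e => h1 (e ▸ hu)
      have e2 : r ≠ 0 := fun e => h2 (e ▸ hr)
      have e3 : u ≠ j := fun e => h3 (e ▸ hu)
      have e4 : r ≠ j := fun e => h4 (e ▸ hr)
      have e5 : u ≠ r := fun e => Finset.disjoint_left.1 h5 hu (e ▸ hr)
      refine @MeasurableSet.compl _ _ (_) (measurableSet_orient e1 e2 e5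
        (not_touching_link (fun e => e5 (Fin.ext e)) ?_))
      rintro (e | e | e | e)
      · exact e1 (Fin.ext e)
      · exact e3 (Fin.ext e)
      · exact e2 (Fin.ext e)
      · exact e4 (Fin.ext e)
    · have : G a = ∅ := Set.eq_empty_of_forall_notMem fun ω hω => ha hω.1
      rw [this]
      exact @MeasurableSet.empty _ (_)
  · intro a
    by_cases ha : 0 ∉ S a ∧ 0 ∉ T a ∧ j ∉ S a ∧ j ∉ T a ∧ Disjoint (S a) (T a) ∧
        s * t ≤ (S a).card * (T a).card
    · refine (measureReal_mono fun ω hω => hω.2).trans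
        ((h.measureReal_no_orient_le ha.1 ha.2.1 ha.2.2.2.2.1).trans ?_)
      refine Real.exp_le_exp.2 (neg_le_neg ?_)
      exact mul_le_mul_of_nonneg_left ha.2.2.2.2.2 (by positivity)
    · have : G a = ∅ := Set.eq_empty_of_forall_notMem fun ω hω => ha hω.1
      rw [this, measureReal_empty]
      positivity

end IsModel

end Allcast

/-! ### Failure of Hall's condition and the union bound -/

namespace Allcast

open Classical in
/-- The owners of the bits in `S`, if `N` is the set of the neighbours of the source. -/
noncomputable def ownersOf {V : Type*} [Fintype V] {m : ℕ} (push : PushRule V m) (N : Finset V)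
    (S : Finset (Fin m)) : Finset V :=
  Finset.univ.filter fun v => ∃ b ∈ S, push.owner N b = some v

open Classical in
/-- The nodes in `I` that own no bit, if `N` is the set of the neighbours of the source. -/
noncomputable def relaysIn {V : Type*} {m : ℕ} (push : PushRule V m) (N I : Finset V) : Finset V :=
  I.filter fun r => ∀ b, push.owner N b ≠ some r

theorem mem_ownersOf {V : Type*} [Fintype V] {m : ℕ} {push : PushRule V m} {N : Finset V}
    {S : Finset (Fin m)} {v : V} : v ∈ ownersOf push N S ↔ ∃ b ∈ S, push.owner N b = some v := by
  classical
  simp [ownersOf]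

theorem mem_relaysIn {V : Type*} {m : ℕ} {push : PushRule V m} {N I : Finset V} {r : V} :
    r ∈ relaysIn push N I ↔ r ∈ I ∧ ∀ b, push.owner N b ≠ some r := by
  classical
  simp [relaysIn]

/-- The bits in `S` reach none of the relays outside `U` that have a link to `j`, although there
are at least `k` of these. -/
def Stuck {n m : ℕ} (push : PushRule (Fin (n + 1)) m) (c d : Link → Bool) (k : ℕ)
    (j : Fin (n + 1)) (S : Finset (Fin m)) (U : Finset (Fin (n + 1))) : Prop :=
  ∀ a, nbrs n c d j = a →
    (0 ∉ ownersOf push a.1 S ∧ 0 ∉ relaysIn push a.1 a.2 \ U ∧ j ∉ ownersOf push a.1 S ∧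
      j ∉ relaysIn push a.1 a.2 \ U ∧
      Disjoint (ownersOf push a.1 S) (relaysIn push a.1 a.2 \ U) ∧
      (S.card * k : ℝ) ≤ (ownersOf push a.1 S).card * (relaysIn push a.1 a.2 \ U).card) ∧
    ∀ u ∈ ownersOf push a.1 S, ∀ r ∈ relaysIn push a.1 a.2 \ U, ¬ orient n c d u r

-- A violation of the expansion hypothesis of `Run.exists_matching` is exactly turned into a `Stuck`
-- pair, whose owners and relays are functions of `nbrs`.
open Classical in
theorem allcast_succeeds {n m k : ℕ} {c d : Link → Bool} (push : PushRule (Fin (n + 1)) m)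
    (pull : Fin (n + 1) → PullRule (Fin (n + 1)) m)
    (hdeg : m ≤ (Finset.univ.filter fun v : Fin (n + 1) => (graph n c).Adj 0 v).card)
    (hin : ∀ j : Fin (n + 1), j ≠ 0 →
      m + k ≤ (Finset.univ.filter fun u : Fin (n + 1) => u ≠ 0 ∧ orient n c d u j).card)
    (hstuck : ∀ (j : Fin (n + 1)) (S : Finset (Fin m)) (U : Finset (Fin (n + 1))), j ≠ 0 →
      S.Nonempty → U.card ≤ S.card → ¬ Stuck push c d k j S U) :
    (allcast n c d push pull).Succeeds := by
  set R := allcast n c d push pull with hR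
  have hN : ∀ j, (nbrs n c d j).1 = R.sourceNbrs := fun j => by
    ext v
    simp [nbrs, Run.sourceNbrs, hR, allcast]
  have hI : ∀ j, (nbrs n c d j).2 = R.inNbrs j := fun j => by
    ext v
    simp [nbrs, Run.inNbrs, hR, allcast]
  have hrelays : ∀ j, relaysIn push R.sourceNbrs (R.inNbrs j) = R.inRelays j := fun j => by
    ext r
    rw [mem_relaysIn, Run.mem_inRelays, Run.mem_inNbrs]
    exact ⟨fun h => ⟨⟨h.1.1, h.2⟩, h.1.2⟩, fun h => ⟨⟨h.1.1, h.2⟩, h.1.2⟩⟩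
  have hdeg' : m ≤ R.sourceNbrs.card := by
    convert hdeg using 2
    ext v
    simp [Run.sourceNbrs, hR, allcast]
  refine Run.succeeds_of_matching (allcast_oriented push pull) fun j hj => ?_
  refine Run.exists_matching (d := k) ?_ fun S U hS hSj hU hk => ?_
  · convert hin j hj using 2
    ext v
    simp [Run.inNbrs, hR, allcast]
  by_contra! hno
  refine hstuck j S U hj hS hU ?_
  rintro _ rfl
  rw [hN, hI, hrelays]
  have howner : ∀ u ∈ ownersOf push R.sourceNbrs S, ∃ b ∈ S, R.owner b = some u := fun u hu =>
    mem_ownersOf.1 hu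
  have hrel : ∀ r ∈ R.inRelays j \ U, R.IsRelay r ∧ R.dir r j := fun r hr =>
    Run.mem_inRelays.1 (Finset.mem_sdiff.1 hr).1
  refine ⟨⟨fun h => ?_, fun h => (hrel _ h).1.1 rfl, fun h => ?_, fun h => ?_, ?_, ?_⟩, ?_⟩
  · obtain ⟨b, -, hb⟩ := howner _ h
    exact (Run.adj_of_owner hb).ne rfl
  · obtain ⟨b, hbS, hb⟩ := howner _ h
    exact hSj b hbS hb
  · exact not_orient_self j (hrel _ h).2
  · refine Finset.disjoint_left.2 fun u hu hr => ?_
    obtain ⟨b, -, hb⟩ := howner _ hu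
    exact (hrel _ hr).1.2 b hb
  -- The degree bound gives every bit an owner, and owners of different bits differ, so `S` has at
  -- least `|S|` owners.
  · choose o ho using Run.exists_owner hdeg'
    have h1 : S.card ≤ (ownersOf push R.sourceNbrs S).card :=
      Finset.card_le_card_of_injOn o
        (fun b hb => Finset.mem_coe.2 (mem_ownersOf.2 ⟨b, hb, ho b⟩))
        fun b _ b' _ e => Run.owner_inj (ho b) (e ▸ ho b')
    exact_mod_cast Nat.mul_le_mul h1 hk
  · intro u hu r hr
    obtain ⟨b, hbS, hb⟩ := howner _ hu
    exact hno b hbS r hr u hb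

theorem sum_pow_card {α : Type*} [Fintype α] (y : ℝ) :
    ∑ s : Finset α, y ^ s.card = (1 + y) ^ Fintype.card α := by
  have := Fintype.sum_pow_mul_eq_add_pow α y 1
  simpa [add_comm] using this

/-- The unrestricted sum factors by the binomial theorem; the removed terms, those with empty first
set, sum to a power of `1 + y`, hence to at least 1. -/
theorem sum_pow_card_add_card_le {α β : Type*} [Fintype α] [Fintype β] {y : ℝ} (hy0 : 0 ≤ y) :
    ∑ x : Finset α × Finset β, (if x.1.Nonempty then y ^ (x.1.card + x.2.card) else 0) ≤
      (1 + y) ^ (Fintype.card α + Fintype.card β) - 1 := by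
  classical
  have h2 : ∀ x : Finset α × Finset β, (if x.1.Nonempty then y ^ (x.1.card + x.2.card) else 0) =
      y ^ x.1.card * y ^ x.2.card - if x.1 = ∅ then y ^ x.2.card else 0 := by
    rintro ⟨s, u⟩
    rcases s.eq_empty_or_nonempty with rfl | hs
    · simp
    · simp [hs, hs.ne_empty, pow_add]
  rw [Finset.sum_congr rfl fun x _ => h2 x, Finset.sum_sub_distrib, Fintype.sum_prod_type,
    Fintype.sum_prod_type]
  simp only [← Finset.mul_sum, ← Finset.sum_mul]
  rw [sum_pow_card, sum_pow_card, pow_add]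
  refine sub_le_sub_left ?_ _
  rw [Finset.sum_comm]
  simp only [Finset.sum_ite_eq', Finset.mem_univ, if_true]
  rw [sum_pow_card]
  exact one_le_pow₀ (by linarith)

namespace IsModel

variable {Ω : Type*} [mΩ : MeasurableSpace Ω] {μ : Measure Ω} [IsProbabilityMeasure μ]
  {p : ℝ} {C D : Link → Ω → Bool} {n m k : ℕ}

theorem measureReal_exists_stuck_le (h : IsModel μ p C D) (hp : 0 ≤ p)
    (push : PushRule (Fin (n + 1)) m) {j : Fin (n + 1)} (hj : j ≠ 0) :
    μ.real {ω | ∃ (S : Finset (Fin m)) (U : Finset (Fin (n + 1))), S.Nonempty ∧ U.card ≤ S.card ∧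
        Stuck push (fun e => C e ω) (fun e => D e ω) k j S U} ≤
      2 * ((m + n + 1) * Real.exp (-(p / 4 * k))) := by
  classical
  set y := Real.exp (-(p / 4 * k)) with hy
  have hy0 : 0 < y := Real.exp_pos _
  have hy1 : y ≤ 1 := Real.exp_le_one_iff.2 (by have : 0 ≤ p / 4 * k := by positivity
                                                linarith)
  have hx0 : 0 ≤ (m + n + 1) * y := by positivity
  -- Beyond 1 the claimed bound exceeds 1 and is trivial; below 1, `exp x - 1 ≤ 2x` applies at the
  -- end.
  rcases le_or_gt ((m + n + 1) * y) 1 with hx | hx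
  swap
  · exact measureReal_le_one.trans (by linarith)
  let A : Finset (Fin m) × Finset (Fin (n + 1)) → Set Ω := fun x =>
    {ω | x.1.Nonempty ∧ x.2.card ≤ x.1.card ∧
      Stuck push (fun e => C e ω) (fun e => D e ω) k j x.1 x.2}
  have hA : ∀ x, μ.real (A x) ≤ if x.1.Nonempty then y ^ (x.1.card + x.2.card) else 0 := by
    rintro ⟨S, U⟩
    by_cases hS : S.Nonempty ∧ U.card ≤ S.card
    · rw [if_pos hS.1]
      refine (measureReal_mono fun ω hω => Set.mem_ofPred_eq ▸ hω.2.2).trans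
        ((h.measureReal_no_orient_nbrs_le hp hj (fun a => ownersOf push a.1 S)
          (fun a => relaysIn push a.1 a.2 \ U) S.card k).trans ?_)
      -- The choice `y = exp(-pk/4)` splits the exponent into two halves: one pays for the choice of
      -- `S`, the other, since `|U| ≤ |S|`, for the choice of `U`.
      calc Real.exp (-(p / 2 * (S.card * k))) = y ^ (S.card + S.card) := by
            rw [hy, ← Real.exp_nat_mul]
            congr 1
            push_cast
            ring
        _ ≤ y ^ (S.card + U.card) :=
            pow_le_pow_of_le_one hy0.le hy1 (Nat.add_le_add_left hS.2 _)
    · have : A (S, U) = ∅ := Set.eq_empty_of_forall_notMem fun ω hω => hS ⟨hω.1, hω.2.1⟩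
      rw [this, measureReal_empty]
      split_ifs
      · positivity
      · exact le_rfl
  calc μ.real _ ≤ μ.real (⋃ x, A x) := measureReal_mono (by
        rintro ω ⟨S, U, hω⟩
        exact Set.mem_iUnion.2 ⟨(S, U), hω⟩)
    _ ≤ ∑ x, μ.real (A x) := measureReal_iUnion_fintype_le _
    _ ≤ _ := Finset.sum_le_sum fun x _ => hA x
    _ ≤ (1 + y) ^ (m + (n + 1)) - 1 := by
        simpa using sum_pow_card_add_card_le (α := Fin m) (β := Fin (n + 1)) hy0.le
    _ ≤ Real.exp ((m + n + 1) * y) - 1 := by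
        refine sub_le_sub_right ?_ _
        refine (pow_le_pow_left₀ (by positivity) (add_comm 1 y ▸ Real.add_one_le_exp y) _).trans ?_
        rw [← Real.exp_nat_mul]
        push_cast
        rw [add_assoc]
    _ ≤ 2 * ((m + n + 1) * y) := by
        have := Real.abs_exp_sub_one_le (x := (m + n + 1) * y) (by rwa [abs_of_nonneg hx0])
        rw [abs_of_nonneg hx0] at this
        exact (le_abs_self _).trans this

/-- The probability that a run of ALLCAST fails, for large `n`. -/
theorem measureReal_not_succeeds_le (h : IsModel μ p C D) (hp : 0 ≤ p)
    (push : PushRule (Fin (n + 1)) m) (pull : Fin (n + 1) → PullRule (Fin (n + 1)) m)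
    (hn : 2 ≤ n) {t : ℝ} (ht : 0 ≤ t) (hmk : (m + k : ℝ) < (n - 1) * (p / 2) - t) :
    μ.real {ω | ¬ (allcast n (fun e => C e ω) (fun e => D e ω) push pull).Succeeds} ≤
      Real.exp (-(2 * t ^ 2 / n)) + (n + 1) * (Real.exp (-(2 * t ^ 2 / n)) +
        2 * ((m + n + 1) * Real.exp (-(p / 4 * k)))) := by
  classical
  have hn' : ((n - 1 : ℕ) : ℝ) = n - 1 := by
    rw [Nat.cast_sub (by omega), Nat.cast_one]
  have hn2 : (2 : ℝ) ≤ n := by exact_mod_cast hn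
  let A : Set Ω := {ω | ((Finset.univ.filter fun v : Fin (n + 1) =>
        (graph n fun e => C e ω).Adj 0 v).card : ℝ) ≤ n * p - t}
  let B : Fin (n + 1) → Set Ω := fun j => {ω | j ≠ 0 ∧ ((Finset.univ.filter fun u : Fin (n + 1) =>
        u ≠ 0 ∧ orient n (fun e => C e ω) (fun e => D e ω) u j).card : ℝ) ≤
          (n - 1 : ℕ) * (p / 2) - t}
  let E : Fin (n + 1) → Set Ω := fun j => {ω | j ≠ 0 ∧
      ∃ (S : Finset (Fin m)) (U : Finset (Fin (n + 1))), S.Nonempty ∧ U.card ≤ S.card ∧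
        Stuck push (fun e => C e ω) (fun e => D e ω) k j S U}
  have hsub : {ω | ¬ (allcast n (fun e => C e ω) (fun e => D e ω) push pull).Succeeds} ⊆
      A ∪ ⋃ j, (B j ∪ E j) := by
    intro ω hω
    by_contra hno
    simp only [Set.mem_union, Set.mem_iUnion, not_or, not_exists] at hno
    obtain ⟨hA, hBE⟩ := hno
    refine hω (allcast_succeeds (k := k) push pull ?_ ?_ ?_)
    · have hA : n * p - t < _ := lt_of_not_ge hA
      have : (m : ℝ) ≤ n * p - t := by
        have : (0 : ℝ) ≤ k := Nat.cast_nonneg k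
        nlinarith
      exact_mod_cast (this.trans_lt hA).le
    · intro j hj
      have hB : _ < _ := lt_of_not_ge fun h' => (hBE j).1 ⟨hj, h'⟩
      rw [hn'] at hB
      have := (hmk.trans hB).le
      exact_mod_cast this
    · intro j S U hj hS hU hst
      exact (hBE j).2 ⟨hj, S, U, hS, hU, hst⟩
  have hB : ∀ j, μ.real (B j) ≤ Real.exp (-(2 * t ^ 2 / n)) := by
    intro j
    by_cases hj : j = 0
    · have : B j = ∅ := Set.eq_empty_of_forall_notMem fun ω hω => hω.1 hj
      rw [this, measureReal_empty]
      positivity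
    · refine (measureReal_mono fun ω hω => hω.2).trans
        ((h.measureReal_card_inNbrs_le hj ht).trans ?_)
      refine Real.exp_le_exp.2 (neg_le_neg ?_)
      rw [hn']
      exact div_le_div_of_nonneg_left (by positivity) (by linarith) (by linarith)
  have hE : ∀ j, μ.real (E j) ≤ 2 * ((m + n + 1) * Real.exp (-(p / 4 * k))) := by
    intro j
    by_cases hj : j = 0
    · have : E j = ∅ := Set.eq_empty_of_forall_notMem fun ω hω => hω.1 hj
      rw [this, measureReal_empty]
      positivity
    · exact (measureReal_mono fun ω hω => hω.2).trans (h.measureReal_exists_stuck_le hp push hj)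
  calc μ.real _ ≤ μ.real (A ∪ ⋃ j, (B j ∪ E j)) := measureReal_mono hsub
    _ ≤ μ.real A + ∑ j, μ.real (B j ∪ E j) :=
        (measureReal_union_le _ _).trans (add_le_add_right (measureReal_iUnion_fintype_le _) _)
    _ ≤ Real.exp (-(2 * t ^ 2 / n)) + ∑ _j : Fin (n + 1), (Real.exp (-(2 * t ^ 2 / n)) +
        2 * ((m + n + 1) * Real.exp (-(p / 4 * k)))) :=
        add_le_add (h.measureReal_card_sourceNbrs_le ht) (Finset.sum_le_sum fun j _ =>
          (measureReal_union_le _ _).trans (add_le_add (hB j) (hE j)))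
    _ = _ := by
        rw [Finset.sum_const, Finset.card_univ, Fintype.card_fin, nsmul_eq_mul]
        push_cast
        ring

end IsModel

end Allcast

/-! ### Choice of parameters and Borel–Cantelli -/

namespace Allcast

theorem numBits_eq_zero {N : ℕ} {p ε : ℝ} (hp : 0 ≤ p) (h : p = 0 ∨ 1 ≤ ε) :
    numBits N p ε = 0 := by
  refine Nat.ceil_eq_zero.2 ?_
  rcases h with rfl | h
  · simp
  · have : (N : ℝ) * p * (1 - ε) ≤ 0 := mul_nonpos_of_nonneg_of_nonpos (by positivity) (by linarith)
    linarith

/-- Halving `ε` gains `nε/2 ≥ 1` in the product, which pays for replacing `n` by `n + 1`. -/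
theorem numBits_succ_le {n : ℕ} {p ε : ℝ} (hp : 0 ≤ p) (hε : 0 < ε) (hn : 2 / ε ≤ n) :
    numBits (n + 1) p ε ≤ numBits n p (ε / 2) := by
  refine Nat.ceil_mono ?_
  rw [div_le_iff₀ hε] at hn
  push_cast
  nlinarith

theorem Run.succeeds_of_eq_zero {V : Type*} [Fintype V] {m : ℕ} (R : Run V m) (hm : m = 0) :
    R.Succeeds := by
  subst hm
  exact ⟨fun _ b => b.elim0, fun _ _ _ b => b.elim0, fun _ _ _ b => b.elim0⟩

theorem PacksSpanningTrees.mono {V : Type*} {G : SimpleGraph V} {s : V} {k k' h : ℕ}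
    (hG : PacksSpanningTrees G s k h) (hk : k' ≤ k) : PacksSpanningTrees G s k' h := by
  obtain ⟨T, hT, hd⟩ := hG
  exact ⟨fun i => T (i.castLE hk), fun i => hT _, fun i j hij =>
    hd _ _ fun e => hij (Fin.castLE_injective hk e)⟩

variable {Ω : Type*} [MeasurableSpace Ω] {μ : Measure Ω} [IsProbabilityMeasure μ] {p ε : ℝ}
  {C : Link → Ω → Bool} {D : ℕ → Link → Ω → Bool}

theorem IsModel.of_measure (hp : 0 ≤ p) {D : Link → Ω → Bool} (hCm : ∀ e, Measurable (C e))
    (hDm : ∀ e, Measurable (D e)) (hC : ∀ e, μ {ω | C e ω = true} = ENNReal.ofReal p)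
    (hD : ∀ e, μ {ω | D e ω = true} = 1 / 2) (hind : iIndepFun (Sum.elim C D) μ) :
    IsModel μ p C D := by
  have htrue : ∀ e, μ.real (D e ⁻¹' {true}) = 1 / 2 := fun e => by
    have : D e ⁻¹' {true} = {ω | D e ω = true} := rfl
    rw [this, Measure.real, hD]
    simp
  refine ⟨hCm, hDm, fun e => ?_, fun e b => ?_, hind⟩
  · have : C e ⁻¹' {true} = {ω | C e ω = true} := rfl
    rw [this, Measure.real, hC, ENNReal.toReal_ofReal hp]
  · cases b
    · have : D e ⁻¹' {false} = (D e ⁻¹' {true})ᶜ := by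
        ext ω
        simp
      rw [this, probReal_compl_eq_one_sub (hDm e (measurableSet_singleton _)), htrue]
      norm_num
    · exact htrue e

theorem IsModel.measureReal_not_succeeds_le_exp {D : Link → Ω → Bool} (h : IsModel μ p C D)
    (hp0 : 0 < p) (hp1 : p ≤ 1) (hε0 : 0 < ε) (hε1 : ε < 1) {n : ℕ} (hn : 2 ≤ n)
    (hδ : 2 ≤ p * ε / 8 * n)
    (push : PushRule (Fin (n + 1)) (numBits n p ε))
    (pull : Fin (n + 1) → PullRule (Fin (n + 1)) (numBits n p ε)) :
    μ.real {ω | ¬ (allcast n (fun e => C e ω) (fun e => D e ω) push pull).Succeeds} ≤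
      9 * (n ^ 2 * Real.exp (-(min (2 * (p * ε / 8) ^ 2) (p / 4 * (p * ε / 8))) * n)) := by
  set δ := p * ε / 8 with hδdef
  set r := min (2 * δ ^ 2) (p / 4 * δ) with hr
  have hn2 : (2 : ℝ) ≤ n := by exact_mod_cast hn
  have hm : (numBits n p ε : ℝ) < n * p * (1 - ε) / 2 + 1 := by
    refine Nat.ceil_lt_add_one ?_
    have := sub_pos.2 hε1
    positivity
  have hk : (⌈δ * n⌉₊ : ℝ) < δ * n + 1 := Nat.ceil_lt_add_one (by linarith)
  have hk' : δ * n ≤ (⌈δ * n⌉₊ : ℝ) := Nat.le_ceil _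
  -- The gap between `np/2` and `np(1-ε)/2` is `4δn`: one `δn` is the surplus `k`, one the deviation
  -- `t`, and the other two, at least 4 together, cover both roundings and the loss `p/2` from
  -- having `n - 1` candidates.
  have hmk : (numBits n p ε + ⌈δ * n⌉₊ : ℝ) < (n - 1) * (p / 2) - δ * n := by
    have : n * p * (1 - ε) / 2 = n * p / 2 - 4 * (δ * n) := by
      rw [hδdef]
      ring
    linarith
  have hmn : (numBits n p ε : ℝ) ≤ n := by nlinarith
  have key := h.measureReal_not_succeeds_le hp0.le push pull hn (by linarith) hmk
  refine key.trans ?_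
  have h1 : Real.exp (-(2 * (δ * n) ^ 2 / n)) ≤ Real.exp (-r * n) := by
    refine Real.exp_le_exp.2 ?_
    have : 2 * (δ * n) ^ 2 / n = 2 * δ ^ 2 * n := by
      field_simp
    rw [this, neg_mul]
    exact neg_le_neg (mul_le_mul_of_nonneg_right (min_le_left _ _) (by linarith))
  have h2 : Real.exp (-(p / 4 * ⌈δ * n⌉₊)) ≤ Real.exp (-r * n) := by
    refine Real.exp_le_exp.2 ?_
    rw [neg_mul]
    refine neg_le_neg ((mul_le_mul_of_nonneg_right (min_le_right _ _) (by linarith)).trans ?_)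
    rw [mul_assoc]
    exact mul_le_mul_of_nonneg_left hk' (by positivity)
  set x := Real.exp (-r * n)
  have hx : 0 < x := Real.exp_pos _
  calc _ ≤ x + (n + 1) * (x + 2 * ((n + n + 1) * x)) := by gcongr
    _ = (4 * n ^ 2 + 7 * n + 4) * x := by ring
    _ ≤ (9 * n ^ 2) * x := by
        refine mul_le_mul_of_nonneg_right ?_ hx.le
        nlinarith
    _ = 9 * (n ^ 2 * x) := by ring

theorem ae_eventually_succeeds (h : ∀ n, IsModel μ p C (D n)) (hp0 : 0 < p) (hp1 : p ≤ 1)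
    (hε0 : 0 < ε) (hε1 : ε < 1)
    (push : ∀ n : ℕ, PushRule (Fin (n + 1)) (numBits n p ε))
    (pull : ∀ n : ℕ, Fin (n + 1) → PullRule (Fin (n + 1)) (numBits n p ε)) :
    ∀ᵐ ω ∂μ, ∀ᶠ n : ℕ in atTop,
      (allcast n (fun e => C e ω) (fun e => D n e ω) (push n) (pull n)).Succeeds := by
  have hδ : 0 < p * ε / 8 := by positivity
  have hr : 0 < min (2 * (p * ε / 8) ^ 2) (p / 4 * (p * ε / 8)) := by positivity
  have hlarge : ∀ᶠ n : ℕ in atTop, 2 ≤ n ∧ 2 ≤ p * ε / 8 * n :=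
    (eventually_ge_atTop 2).and
      ((tendsto_natCast_atTop_atTop.const_mul_atTop hδ).eventually_ge_atTop 2)
  -- Requiring `n` to be large inside the event makes it empty for small `n`, so the summable bound
  -- holds for every `n`.
  let A : ℕ → Set Ω := fun n => {ω | (2 ≤ n ∧ 2 ≤ p * ε / 8 * n) ∧
    ¬ (allcast n (fun e => C e ω) (fun e => D n e ω) (push n) (pull n)).Succeeds}
  have hA : ∀ n, μ (A n) ≤ ENNReal.ofReal (9 * (n ^ 2 *
      Real.exp (-(min (2 * (p * ε / 8) ^ 2) (p / 4 * (p * ε / 8))) * n))) := by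
    intro n
    by_cases hn : 2 ≤ n ∧ 2 ≤ p * ε / 8 * n
    · rw [← ofReal_measureReal]
      exact ENNReal.ofReal_le_ofReal ((measureReal_mono fun ω hω => hω.2).trans
        ((h n).measureReal_not_succeeds_le_exp hp0 hp1 hε0 hε1 hn.1 hn.2 (push n) (pull n)))
    · have : A n = ∅ := Set.eq_empty_of_forall_notMem fun ω hω => hn hω.1
      rw [this, measure_empty]
      exact zero_le
  have hsum : ∑' n, μ (A n) ≠ ⊤ :=
    ne_top_of_le_ne_top
      ((Real.summable_pow_mul_exp_neg_nat_mul 2 hr).mul_left 9).tsum_ofReal_ne_top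
      (ENNReal.tsum_le_tsum hA)
  filter_upwards [ae_eventually_notMem hsum] with ω hω
  filter_upwards [hω, hlarge] with n hn hn'
  by_contra hfail
  exact hn ⟨hn', hfail⟩

end Allcast

theorem mainTheorem3 {Ω : Type*} [MeasurableSpace Ω] (μ : Measure Ω) [IsProbabilityMeasure μ]
    (p : ℝ) (hp0 : 0 ≤ p) (hp1 : p ≤ 1) (ε : ℝ) (hε : 0 < ε)
    (C : Allcast.Link → Ω → Bool) (D : ℕ → Allcast.Link → Ω → Bool)
    (hCm : ∀ e, Measurable (C e)) (hDm : ∀ n e, Measurable (D n e))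
    (hC : ∀ e, μ {ω | C e ω = true} = ENNReal.ofReal p)
    (hD : ∀ n e, μ {ω | D n e ω = true} = 1 / 2)
    (hind : ∀ n, iIndepFun (Sum.elim C (D n)) μ)
    (push : ∀ n : ℕ, Allcast.PushRule (Fin (n + 1)) (Allcast.numBits n p ε))
    (pull : ∀ n : ℕ, Fin (n + 1) → Allcast.PullRule (Fin (n + 1)) (Allcast.numBits n p ε)) :
    ∀ᵐ ω ∂μ, ∀ᶠ n : ℕ in atTop,
      (Allcast.allcast n (fun e => C e ω) (fun e => D n e ω) (push n) (pull n)).Succeeds ∧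
      Allcast.PacksSpanningTrees (Allcast.graph n (fun e => C e ω)) 0
        (Allcast.numBits (n + 1) p ε) 3 := by
  by_cases htriv : p = 0 ∨ 1 ≤ ε
  · refine Eventually.of_forall fun ω => Eventually.of_forall fun n => ⟨?_, ?_⟩
    · exact Allcast.Run.succeeds_of_eq_zero _ (Allcast.numBits_eq_zero hp0 htriv)
    · rw [Allcast.numBits_eq_zero hp0 htriv]
      exact ⟨fun i => i.elim0, fun i => i.elim0, fun i => i.elim0⟩
  · obtain ⟨hp, hε1⟩ := not_or.1 htriv
    have hp : 0 < p := lt_of_le_of_ne hp0 (Ne.symm hp)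
    have hε1 : ε < 1 := not_le.1 hε1
    have hmodel : ∀ n, Allcast.IsModel μ p C (D n) := fun n =>
      Allcast.IsModel.of_measure hp0 hCm (hDm n) hC (hD n) (hind n)
    filter_upwards [Allcast.ae_eventually_succeeds hmodel hp hp1 hε hε1 push pull,
      -- A second run on the same links and coins, at `ε/2` and with arbitrary rules, supplies
      -- enough trees for the count with `n + 1`.
      Allcast.ae_eventually_succeeds hmodel hp hp1 (half_pos hε) (by linarith)
        (fun n => Classical.arbitrary _) (fun n => Classical.arbitrary _)] with ω h1 h2
    filter_upwards [h1, h2, tendsto_natCast_atTop_atTop.eventually_ge_atTop (2 / ε)]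
      with n h1 h2 hn
    exact ⟨h1, h2.packsSpanningTrees.mono (Allcast.numBits_succ_le hp0 hε hn)⟩
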